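/- **Quantum overlapping tomography by random Pauli measurements.** Let $\rho$ be an $n$-qubit density operator. In one *round*, each qubit of a fresh copy of $\rho$ is measured in a basis chosen uniformly and independently from $\{\sigma_X,\sigma_Y,\sigma_Z\}$, and the $n$ bases and the $n$ outcomes $\pm1$ are recorded. For a set $S$ of $k$ qubits and a Pauli string $Q\in\{I,\sigma_X,\sigma_Y,\sigma_Z\}^{\otimes S}$, a round is *useful* for $Q$ if every qubit of $S$ on which $Q$ is not the identity was measured in the basis given by $Q$; let $\hat\mu_Q$ be the average, over the useful rounds, of the product of the outcomes on the support of $Q$ (and $\hat\mu_Q=0$ if there is no useful round). Let $\hat\rho_S=2^{-k}\sum_Q\hat\mu_Q\,Q$ be the resulting estimate of the reduced density operator $\rho_S=\operatorname{Tr}_{\bar S}\rho$. Let $\|A\|_1=\operatorname{Tr}\sqrt{A^\dagger A}$ and let $\log$ be the natural logarithm. 1. Let $0\le k\le n$, $0<\varepsilon\le 2$, $0<\delta<1$, and let $N$ be any integer with $$N\ \ge\ 32\cdot 10^k\cdot\varepsilon^{-2}\cdot\log\Big(2\tbinom nk\big/\delta\Big).$$ Then for every $n$-qubit state $\rho$,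 with probability at least $1-\delta$ over $N$ independent rounds, $\|\hat\rho_S-\rho_S\|_1\le\varepsilon$ holds simultaneously for all $S\subseteq\{1,\dots,n\}$ with $|S|=k$. 2. For every $\delta\in(0,1)$ there is a constant $C>0$, depending only on $\delta$, such that for all $n,k$, all $0<\varepsilon\le2$, every family $F$ of $m\ge2$ sets of $k$ qubits each, and every integer $N\ge C\cdot 10^k\log m/\varepsilon^2$: for every $n$-qubit state $\rho$, with probability at least $1-\delta$ over $N$ independent rounds, $\|\hat\rho_S-\rho_S\|_1\le\varepsilon$ holds simultaneously for all $S\in F$. -/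

import Mathlib

namespace PauliTomography

/-- The three single-qubit measurement bases. -/
inductive Axis where
  | X | Y | Z
  deriving DecidableEq

instance : Fintype Axis where
  elems := {Axis.X, Axis.Y, Axis.Z}
  complete := by intro a; cases a <;> simp

/-- Operators on a register of qubits labelled by `ι`, as matrices in the computational basis. -/
abbrev Op (ι : Type) : Type := Matrix (ι → Fin 2) (ι → Fin 2) ℂ

open scoped ComplexOrder in
/-- Density operators: positive semidefinite with trace one. -/
def IsDensity {ι : Type} [Fintype ι] [DecidableEq ι] (ρ : Op ι) : Prop :=
  ρ.PosSemidef ∧ ρ.trace = 1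

/-- The single-qubit Pauli matrices. -/
def pauli : Axis → Matrix (Fin 2) (Fin 2) ℂ
  | .X => !![0, 1; 1, 0]
  | .Y => !![0, -Complex.I; Complex.I, 0]
  | .Z => !![1, 0; 0, -1]

/-- Single-qubit Pauli operators including the identity, which is labelled `none`. -/
def pauliI : Option Axis → Matrix (Fin 2) (Fin 2) ℂ
  | none => 1
  | some a => pauli a

/-- The tensor product `⨂ i, A i` of single-qubit matrices. -/
def tensor {ι : Type} [Fintype ι] (A : ι → Matrix (Fin 2) (Fin 2) ℂ) : Op ι :=
  Matrix.of fun x y => ∏ i, A i (x i) (y i)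

/-- The eigenvalue recorded by an outcome bit: bit `0` stands for `+1`, bit `1` for `-1`. -/
def sgn (b : Fin 2) : ℝ := if b = 0 then 1 else -1

/-- The projector onto the eigenspace of `pauli a` with eigenvalue `sgn b`. -/
noncomputable def eigenProj (a : Axis) (b : Fin 2) : Matrix (Fin 2) (Fin 2) ℂ :=
  (1 / 2 : ℂ) • (1 + (sgn b : ℂ) • pauli a)

/-- The record of one round: the basis used on each qubit and the outcome bit of each qubit. -/
abbrev Round (n : ℕ) : Type := (Fin n → Axis) × (Fin n → Fin 2)

/-- Probability of the record `r` when each qubit of one fresh copy of `ρ` is measured in a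
basis chosen uniformly and independently among the three Pauli bases (Born rule). -/
noncomputable def roundProb {n : ℕ} (ρ : Op (Fin n)) (r : Round n) : ℝ :=
  (1 / 3 : ℝ) ^ n * (Matrix.trace (ρ * tensor fun i => eigenProj (r.1 i) (r.2 i))).re

/-- Probability of the records `ω` of `N` independent rounds. -/
noncomputable def dataProb {n N : ℕ} (ρ : Op (Fin n)) (ω : Fin N → Round n) : ℝ :=
  ∏ t, roundProb ρ (ω t)

/-- The basis state of the whole register that is `a` on `S` and `c` off `S`. -/
def glue {n : ℕ} (S : Finset (Fin n)) (a : S → Fin 2) (c : {i // i ∉ S} → Fin 2) :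
    Fin n → Fin 2 :=
  fun i => if h : i ∈ S then a ⟨i, h⟩ else c ⟨i, h⟩

/-- The reduced density operator on `S`: the partial trace over the qubits outside `S`. -/
noncomputable def marginal {n : ℕ} (S : Finset (Fin n)) (ρ : Op (Fin n)) : Op S :=
  Matrix.of fun a b => ∑ c : {i // i ∉ S} → Fin 2, ρ (glue S a c) (glue S b c)

/-- The Pauli string `Q` on `S` corresponds to the bases `P`: on each qubit of `S` it is either
the identity or the operator that was measured there. -/
def Corresponds {n : ℕ} {S : Finset (Fin n)} (Q : S → Option Axis) (P : Fin n → Axis) : Prop :=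
  ∀ i : S, Q i = none ∨ Q i = some (P i)

open Classical in
/-- The rounds that yield a sample of the Pauli string `Q`. -/
noncomputable def usefulRounds {n N : ℕ} {S : Finset (Fin n)} (ω : Fin N → Round n)
    (Q : S → Option Axis) : Finset (Fin N) :=
  Finset.univ.filter fun t => Corresponds Q (ω t).1

/-- The value of the Pauli string `Q` read off from the outcome bits `s`: the product of the
recorded eigenvalues over the support of `Q`. -/
noncomputable def outcomeValue {n : ℕ} {S : Finset (Fin n)} (Q : S → Option Axis)
    (s : Fin n → Fin 2) : ℝ :=
  ∏ i : S, if Q i = none then 1 else sgn (s i)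

/-- The empirical mean of the samples of `Q` (it is `0` if there are none). -/
noncomputable def empiricalMean {n N : ℕ} {S : Finset (Fin n)} (ω : Fin N → Round n)
    (Q : S → Option Axis) : ℝ :=
  (∑ t ∈ usefulRounds ω Q, outcomeValue Q (ω t).2) / ((usefulRounds ω Q).card : ℝ)

/-- The estimate of the marginal on `S`: each coefficient `Tr (ρ_S Q)` of the Pauli expansion
`ρ_S = 2^(-|S|) ∑ Q, Tr (ρ_S Q) Q` is replaced by the empirical mean of the samples of `Q`. -/
noncomputable def estimate {n N : ℕ} (S : Finset (Fin n)) (ω : Fin N → Round n) : Op S :=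
  ∑ Q : S → Option Axis,
    ((empiricalMean ω Q / 2 ^ S.card : ℝ) : ℂ) • tensor fun i => pauliI (Q i)

/-- The trace norm `Tr √(Aᴴ A)`, the sum of the singular values of `A`. -/
noncomputable def traceNorm {m : Type} [Fintype m] [DecidableEq m] (A : Matrix m m ℂ) : ℝ :=
  ∑ i, √((Matrix.isHermitian_conjTranspose_mul_self A).eigenvalues i)

open Classical in
/-- The probability that `N` rounds of random Pauli measurements on copies of `ρ` give, for all
`S` in the family `F` simultaneously, an estimate of the marginal on `S` with error at
most `ε` in trace norm. -/
noncomputable def successProb {n : ℕ} (ρ : Op (Fin n)) (N : ℕ) (F : Finset (Finset (Fin n)))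
    (ε : ℝ) : ℝ :=
  ∑ ω : Fin N → Round n,
    if ∀ S ∈ F, traceNorm (estimate S ω - marginal S ρ) ≤ ε then dataProb ρ ω else 0

end PauliTomography

/-! Trace norm is controlled by a Euclidean norm. Cauchy–Schwarz on singular values gives `‖A‖₁² ≤
2^k ‖A‖_F²`, and orthogonality of Pauli strings turns the right side into the sum of squared Pauli
coefficients. So the error on `S` is at most the length of the vector of errors of the `4^k`
empirical means (`traceNorm_estimate_sub_marginal_le`). Bounding this length as a whole, rather than
each coefficient separately, is what produces `10^k`.

Fix the bases first, and let `m_Q` be the number of rounds useful for `Q`. The outcomes are then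
independent and unbiased, so the error vector has mean square at most `∑ 1/m_Q`, and the squared
bounded-difference constants of its length sum to at most `4 ∑ 1/m_Q`. If `∑ 1/m_Q ≤ V` and `4V ≤
ε²`, the mean length is at most `ε/2`, and McDiarmid's inequality bounds the failure probability by
`exp(-ε²/(8V))` (`sum_prod_empirical_tail`).

Now randomise the bases. A round is useful for `Q` with probability `r_Q = 3^(-|supp Q|)`, and `∑
1/r_Q = (1 + 3·3)^k = 10^k`. A Chernoff bound (`sum_prod_card_lt_le`) and a union over `Q` show that
all `m_Q ≥ N r_Q/4` except with probability `exp(-x)`, where `x = N ε²/(32·10^k)`. On this event `V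
= 4·10^k/N` is admissible and the tail is again `exp(-x)`. One marginal thus fails with probability
at most `2 exp(-x)`; a union over the family finishes. -/

namespace PauliTomography

open Finset

/-! ### Concentration inequalities for finite product distributions. -/

section FiniteProbability

variable {α : Type} [Fintype α]

/-- Hoeffding's lemma for a finitely supported probability vector. -/
lemma sum_mul_exp_le_of_sub_le {p : α → ℝ} (hp : p ∈ stdSimplex ℝ α) {g : α → ℝ} {c : ℝ}
    (hg : ∀ a b, g a - g b ≤ c) :
    ∑ a, p a * Real.exp (g a) ≤ Real.exp (∑ a, p a * g a + c ^ 2 / 8) := by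
  classical
  have hne : Nonempty α := by
    by_contra h
    rw [not_nonempty_iff] at h
    simpa using hp.2
  obtain ⟨b, hb⟩ := Finite.exists_min g
  let _ : MeasurableSpace α := ⊤
  -- The probability vector is realised as a mixture of Dirac masses, so that the measure-theoretic
  -- Hoeffding lemma applies.
  let μ : MeasureTheory.Measure α :=
    ∑ a, ENNReal.ofReal (p a) • MeasureTheory.Measure.dirac a
  have hint : ∀ f : α → ℝ, ∫ x, f x ∂μ = ∑ a, p a * f a := by
    intro f
    rw [MeasureTheory.integral_finsetSum_measure]
    · refine sum_congr rfl fun a _ => ?_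
      rw [MeasureTheory.integral_smul_measure, MeasureTheory.integral_dirac,
        ENNReal.toReal_ofReal (hp.1 a), smul_eq_mul]
    · intro a _
      exact (MeasureTheory.integrable_dirac (by simp)).smul_measure (by simp)
  have : MeasureTheory.IsProbabilityMeasure μ := by
    constructor
    simp only [μ, MeasureTheory.Measure.coe_finsetSum, Finset.sum_apply,
      MeasureTheory.Measure.smul_apply, MeasureTheory.measure_univ, smul_eq_mul, mul_one]
    rw [← ENNReal.ofReal_sum_of_nonneg fun a _ => hp.1 a, hp.2, ENNReal.ofReal_one]
  have h := (ProbabilityTheory.hasSubgaussianMGF_of_mem_Icc (μ := μ) (X := g) (a := g b)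
    (b := g b + c) (by fun_prop)
    (Filter.Eventually.of_forall fun x => ⟨hb x, by linarith [hg x b]⟩)).mgf_le 1
  rw [ProbabilityTheory.mgf, hint, hint] at h
  simp only [one_mul, add_sub_cancel_left, NNReal.coe_pow, NNReal.coe_div, coe_nnnorm,
    NNReal.coe_ofNat, one_pow, mul_one, Real.norm_eq_abs, div_pow, sq_abs, Real.exp_sub] at h
  have h2 : ∑ a, p a * (Real.exp (g a) / Real.exp (∑ a, p a * g a)) =
      (∑ a, p a * Real.exp (g a)) / Real.exp (∑ a, p a * g a) := by
    rw [sum_div]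
    exact sum_congr rfl fun a _ => (mul_div_assoc _ _ _).symm
  rw [h2, div_le_iff₀ (Real.exp_pos _), ← Real.exp_add] at h
  refine h.trans (Real.exp_le_exp.2 (le_of_eq ?_))
  ring

lemma sum_fin_succ_fun {M : Type*} [AddCommMonoid M] {N : ℕ} (F : (Fin (N + 1) → α) → M) :
    ∑ ω, F ω = ∑ ω : Fin N → α, ∑ a, F (Fin.cons a ω : Fin (N + 1) → α) := by
  rw [← (Fin.consEquiv fun _ => α).sum_comp, Fintype.sum_prod_type, sum_comm]
  rfl

lemma sum_prod_eq_one {N : ℕ} {q : Fin N → α → ℝ} (hq : ∀ t, q t ∈ stdSimplex ℝ α) :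
    ∑ ω : Fin N → α, ∏ t, q t (ω t) = 1 := by
  rw [← Fintype.prod_sum]
  exact prod_eq_one fun t _ => (hq t).2

/-- The exponential moment bound behind McDiarmid's inequality. -/
lemma sum_prod_mul_exp_le {N : ℕ} {q : Fin N → α → ℝ} (hq : ∀ t, q t ∈ stdSimplex ℝ α)
    {f : (Fin N → α) → ℝ} {c : Fin N → ℝ}
    (hf : ∀ t ω a b, f (Function.update ω t a) - f (Function.update ω t b) ≤ c t) :
    ∑ ω, (∏ t, q t (ω t)) * Real.exp (f ω) ≤
      Real.exp (∑ ω, (∏ t, q t (ω t)) * f ω + (∑ t, c t ^ 2) / 8) := by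
  induction N with
  | zero => simp
  | succ N ih =>
    have hstep : ∀ F : (Fin (N + 1) → α) → ℝ,
        ∑ ω, (∏ t, q t (ω t)) * F ω = ∑ ω : Fin N → α, (∏ t, q t.succ (ω t)) *
          ∑ a, q 0 a * F (Fin.cons a ω : Fin (N + 1) → α) := by
      intro F
      rw [sum_fin_succ_fun]
      refine sum_congr rfl fun ω _ => ?_
      rw [mul_sum]
      refine sum_congr rfl fun a _ => ?_
      rw [Fin.prod_univ_succ]
      simp only [Fin.cons_zero, Fin.cons_succ]
      ring
    rw [hstep, hstep]
    -- Averaging over the first coordinate preserves the bounded differences in the others.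
    have hg := ih (q := fun t => q t.succ) (fun t => hq t.succ)
      (f := fun ω => ∑ a, q 0 a * f (Fin.cons a ω : Fin (N + 1) → α)) (c := fun t => c t.succ)
      (by
        intro t ω a b
        rw [← sum_sub_distrib]
        calc _ ≤ ∑ x, q 0 x * c t.succ := by
              refine sum_le_sum fun x _ => ?_
              rw [← mul_sub, Fin.cons_update, Fin.cons_update]
              exact mul_le_mul_of_nonneg_left (hf _ _ _ _) ((hq 0).1 x)
          _ = c t.succ := by rw [← sum_mul, (hq 0).2, one_mul])
    calc _ ≤ ∑ ω : Fin N → α, (∏ t, q t.succ (ω t)) *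
          (Real.exp (∑ a, q 0 a * f (Fin.cons a ω : Fin (N + 1) → α)) *
            Real.exp (c 0 ^ 2 / 8)) := by
          refine sum_le_sum fun ω _ => mul_le_mul_of_nonneg_left ?_
            (prod_nonneg fun t _ => (hq _).1 _)
          rw [← Real.exp_add]
          refine sum_mul_exp_le_of_sub_le (hq 0) fun a b => ?_
          have := hf 0 (Fin.cons a ω : Fin (N + 1) → α) a b
          rwa [Fin.update_cons_zero, Fin.update_cons_zero] at this
      _ = (∑ ω : Fin N → α, (∏ t, q t.succ (ω t)) *
          Real.exp (∑ a, q 0 a * f (Fin.cons a ω : Fin (N + 1) → α))) *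
            Real.exp (c 0 ^ 2 / 8) := by
          rw [sum_mul]
          exact sum_congr rfl fun ω _ => (mul_assoc _ _ _).symm
      _ ≤ _ := by
          refine (mul_le_mul_of_nonneg_right hg (Real.exp_pos _).le).trans (le_of_eq ?_)
          rw [← Real.exp_add, Fin.sum_univ_succ (fun t => c t ^ 2)]
          congr 1
          ring

/-- The second moment of a sum of independent centred variables. -/
lemma sum_prod_mul_sq {N : ℕ} {q : Fin N → α → ℝ} (hq : ∀ t, q t ∈ stdSimplex ℝ α)
    {g : Fin N → α → ℝ} (hg : ∀ t, ∑ a, q t a * g t a = 0) (A : ℝ) :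
    ∑ ω : Fin N → α, (∏ t, q t (ω t)) * (A + ∑ t, g t (ω t)) ^ 2 =
      A ^ 2 + ∑ t, ∑ a, q t a * g t a ^ 2 := by
  -- The offset `A` varies so that it can absorb the first summand.
  induction N generalizing A with
  | zero => simp
  | succ N ih =>
    rw [sum_fin_succ_fun, sum_comm]
    have : ∀ a, ∑ ω : Fin N → α, (∏ t, q t ((Fin.cons a ω : Fin (N + 1) → α) t)) *
        (A + ∑ t, g t ((Fin.cons a ω : Fin (N + 1) → α) t)) ^ 2 =
        q 0 a * ((A + g 0 a) ^ 2 + ∑ t : Fin N, ∑ a, q t.succ a * g t.succ a ^ 2) := by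
      intro a
      rw [← ih (q := fun t => q t.succ) (fun t => hq _) (g := fun t => g t.succ)
        (fun t => hg _) (A + g 0 a), mul_sum]
      refine sum_congr rfl fun ω _ => ?_
      rw [Fin.prod_univ_succ, Fin.sum_univ_succ]
      simp only [Fin.cons_zero, Fin.cons_succ]
      ring
    simp only [this]
    rw [Fin.sum_univ_succ]
    have expand : ∀ a, q 0 a * ((A + g 0 a) ^ 2 +
        ∑ t : Fin N, ∑ a, q t.succ a * g t.succ a ^ 2) =
        q 0 a * (A ^ 2 + ∑ t : Fin N, ∑ a, q t.succ a * g t.succ a ^ 2) +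
          2 * A * (q 0 a * g 0 a) + q 0 a * g 0 a ^ 2 := fun a => by ring
    simp only [expand, sum_add_distrib]
    rw [← sum_mul, ← mul_sum, hg, (hq 0).2]
    ring

/-- Concentration of the vector of empirical means of several statistics, where statistic `j`
is sampled in the rounds `U j` of `N` independent rounds. -/
lemma sum_prod_empirical_tail {ι : Type} [Fintype ι] {N : ℕ} {q : Fin N → α → ℝ}
    (hq : ∀ t, q t ∈ stdSimplex ℝ α) (U : ι → Finset (Fin N)) (hU : ∀ j, (U j).Nonempty)
    {v : ι → α → ℝ} (hv : ∀ j a, |v j a| ≤ 1) {μ : ι → ℝ}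
    (hμ : ∀ j, ∀ t ∈ U j, ∑ a, q t a * v j a = μ j) {V ε : ℝ} (hV : 0 < V) (hε : 0 < ε)
    (hUV : ∑ j, (1 : ℝ) / (U j).card ≤ V) (hVε : 4 * V ≤ ε ^ 2) :
    (∑ ω : Fin N → α, (∏ t, q t (ω t)) *
      if √(∑ j, ((∑ t ∈ U j, v j (ω t)) / (U j).card - μ j) ^ 2) ≤ ε then 0 else 1) ≤
      Real.exp (-(ε ^ 2 / (8 * V))) := by
  classical
  have hm : ∀ j, (0 : ℝ) < (U j).card := fun j => by exact_mod_cast (hU j).card_pos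
  have hw : ∀ ω : Fin N → α, 0 ≤ ∏ t, q t (ω t) := fun ω => prod_nonneg fun t _ => (hq _).1 _
  let x : (Fin N → α) → EuclideanSpace ℝ ι := fun ω =>
    WithLp.toLp 2 fun j => (∑ t ∈ U j, v j (ω t)) / (U j).card - μ j
  have hx : ∀ ω, √(∑ j, ((∑ t ∈ U j, v j (ω t)) / (U j).card - μ j) ^ 2) = ‖x ω‖ := by
    intro ω
    simp [EuclideanSpace.norm_eq, x]
  simp only [hx]
  -- Altering round `t` moves coordinate `j` by at most `2 / (U j).card`, and only when `t ∈ U j`.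
  let c : Fin N → ℝ := fun t => √(∑ j, if t ∈ U j then 4 / ((U j).card : ℝ) ^ 2 else 0)
  have hc : ∑ t, c t ^ 2 ≤ 4 * V := by
    have h1 : ∀ t, c t ^ 2 = ∑ j, if t ∈ U j then 4 / ((U j).card : ℝ) ^ 2 else 0 := fun t =>
      Real.sq_sqrt (sum_nonneg fun j _ => by split_ifs <;> positivity)
    simp only [h1]
    rw [sum_comm]
    refine le_trans (le_of_eq ?_) (mul_le_mul_of_nonneg_left hUV (by norm_num : (0 : ℝ) ≤ 4))
    rw [mul_sum]
    refine sum_congr rfl fun j _ => ?_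
    rw [sum_ite_mem, univ_inter, sum_const, nsmul_eq_mul]
    have := (hm j).ne'
    field_simp
  have hdiff : ∀ t ω a b, ‖x (Function.update ω t a)‖ - ‖x (Function.update ω t b)‖ ≤ c t := by
    intro t ω a b
    refine (norm_sub_norm_le _ _).trans ?_
    rw [EuclideanSpace.norm_eq]
    refine Real.sqrt_le_sqrt (sum_le_sum fun j _ => ?_)
    have hx' : (x (Function.update ω t a) - x (Function.update ω t b)) j =
        (∑ s ∈ U j, (v j (Function.update ω t a s) - v j (Function.update ω t b s))) /
          (U j).card := by
      simp only [x, PiLp.sub_apply, sum_sub_distrib]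
      ring
    have hsum : ∑ s ∈ U j, (v j (Function.update ω t a s) - v j (Function.update ω t b s)) =
        if t ∈ U j then v j a - v j b else 0 := by
      rw [← sum_ite_eq' (U j) t fun _ => v j a - v j b]
      refine sum_congr rfl fun s _ => ?_
      by_cases hs : s = t
      · subst hs; simp
      · simp [hs]
    rw [hx', hsum]
    split_ifs with ht
    · rw [Real.norm_eq_abs, sq_abs, div_pow]
      refine div_le_div_of_nonneg_right ?_ (by positivity)
      have h1 := abs_le.1 (hv j a)
      have h2 := abs_le.1 (hv j b)
      nlinarith
    · simp
  have hsq : ∑ ω : Fin N → α, (∏ t, q t (ω t)) * ‖x ω‖ ^ 2 ≤ V := by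
    have h1 : ∀ ω, ‖x ω‖ ^ 2 = ∑ j, (∑ t, if t ∈ U j then
        (v j (ω t) - μ j) / (U j).card else 0) ^ 2 := by
      intro ω
      rw [EuclideanSpace.norm_sq_eq]
      refine sum_congr rfl fun j _ => ?_
      rw [Real.norm_eq_abs, sq_abs, sum_ite_mem, univ_inter, ← sum_div, sum_sub_distrib,
        sum_const, nsmul_eq_mul]
      have := (hm j).ne'
      simp only [x]
      congr 1
      field_simp
    simp only [h1, mul_sum]
    rw [sum_comm]
    refine (sum_le_sum fun j _ => ?_).trans hUV
    have h2 := sum_prod_mul_sq hq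
      (g := fun t a => if t ∈ U j then (v j a - μ j) / (U j).card else 0) (by
        intro t
        split_ifs with ht
        · simp only [mul_div_assoc', mul_sub]
          rw [← sum_div, sum_sub_distrib, hμ j t ht, ← sum_mul, (hq t).2, one_mul, sub_self,
            zero_div]
        · simp) 0
    simp only [zero_add] at h2
    rw [h2]
    have h3 : ∀ t, ∑ a, q t a * (if t ∈ U j then (v j a - μ j) / (U j).card else 0) ^ 2 ≤
        if t ∈ U j then 1 / ((U j).card : ℝ) ^ 2 else 0 := by
      intro t
      split_ifs with ht
      · have h4 : ∀ a, q t a * ((v j a - μ j) / (U j).card) ^ 2 =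
            (q t a * v j a ^ 2 - 2 * μ j * (q t a * v j a) + μ j ^ 2 * q t a) /
              ((U j).card : ℝ) ^ 2 := fun a => by ring
        simp only [h4]
        rw [← sum_div]
        refine div_le_div_of_nonneg_right ?_ (by positivity)
        rw [sum_add_distrib, sum_sub_distrib, ← mul_sum, ← mul_sum, hμ j t ht, (hq t).2]
        have h5 : ∑ a, q t a * v j a ^ 2 ≤ 1 := by
          rw [← (hq t).2]
          refine sum_le_sum fun a _ => mul_le_of_le_one_right ((hq t).1 a) ?_
          rw [sq_le_one_iff_abs_le_one]
          exact hv j a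
        nlinarith [sq_nonneg (μ j)]
      · simp
    refine (add_le_add le_rfl (sum_le_sum fun t _ => h3 t)).trans (le_of_eq ?_)
    rw [sum_ite_mem, univ_inter, sum_const, nsmul_eq_mul]
    have := (hm j).ne'
    field_simp
    ring
  -- Jensen's inequality: the squared mean is at most the mean square, hence at most `V ≤ ε²/4`.
  have hmean : ∑ ω : Fin N → α, (∏ t, q t (ω t)) * ‖x ω‖ ≤ ε / 2 := by
    have h1 := Real.pow_arith_mean_le_arith_mean_pow univ (fun ω : Fin N → α => ∏ t, q t (ω t))
      (fun ω => ‖x ω‖) (fun ω _ => hw ω) (sum_prod_eq_one hq) (fun ω _ => norm_nonneg _) 2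
    refine le_of_sq_le_sq ?_ (by positivity)
    linarith
  -- This `l` minimises the Chernoff exponent `l ε/2 + l² V/2 - l ε`.
  set l : ℝ := ε / (2 * V) with hl
  have hl0 : 0 < l := by positivity
  have hexp := sum_prod_mul_exp_le hq (f := fun ω => l * ‖x ω‖) (c := fun t => l * c t) (by
    intro t ω a b
    rw [← mul_sub]
    exact mul_le_mul_of_nonneg_left (hdiff t ω a b) hl0.le)
  calc _ ≤ ∑ ω : Fin N → α, (∏ t, q t (ω t)) *
        (Real.exp (l * ‖x ω‖) * Real.exp (-(l * ε))) := by
        refine sum_le_sum fun ω _ => mul_le_mul_of_nonneg_left ?_ (hw ω)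
        split_ifs with h
        · positivity
        · rw [← Real.exp_add]
          refine Real.one_le_exp ?_
          nlinarith
    _ = (∑ ω : Fin N → α, (∏ t, q t (ω t)) * Real.exp (l * ‖x ω‖)) *
        Real.exp (-(l * ε)) := by
        rw [sum_mul]
        exact sum_congr rfl fun ω _ => (mul_assoc _ _ _).symm
    _ ≤ _ := by
        refine (mul_le_mul_of_nonneg_right hexp (Real.exp_pos _).le).trans ?_
        rw [← Real.exp_add, Real.exp_le_exp]
        have h1 : ∑ ω : Fin N → α, (∏ t, q t (ω t)) * (l * ‖x ω‖) =
            l * ∑ ω : Fin N → α, (∏ t, q t (ω t)) * ‖x ω‖ := by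
          rw [mul_sum]
          exact sum_congr rfl fun ω _ => by ring
        have h2 : ∑ t, (l * c t) ^ 2 = l ^ 2 * ∑ t, c t ^ 2 := by
          rw [mul_sum]
          exact sum_congr rfl fun t _ => by ring
        rw [h1, h2]
        have h3 := mul_le_mul_of_nonneg_left hmean hl0.le
        have h4 := mul_le_mul_of_nonneg_left hc (sq_nonneg l)
        have h5 : l * (ε / 2) + l ^ 2 * (4 * V) / 8 + -(l * ε) = -(ε ^ 2 / (8 * V)) := by
          rw [hl]; field_simp; ring
        linarith

open Classical in
/-- Lower tail of the number of rounds in which an event of probability `r` occurs. -/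
lemma sum_prod_card_lt_le {w : α → ℝ} (hw : w ∈ stdSimplex ℝ α) (C : α → Prop) {r : ℝ}
    (hr : ∑ a, w a * (if C a then 1 else 0) = r) (N : ℕ) :
    (∑ P : Fin N → α, (∏ t, w (P t)) *
      if ((univ.filter fun t => C (P t)).card : ℝ) < N * r / 4 then 1 else 0) ≤
      Real.exp (-(3 / 8 * (N * r))) := by
  have hr0 : 0 ≤ r := hr ▸ sum_nonneg fun a _ => mul_nonneg (hw.1 a) (by split_ifs <;> norm_num)
  -- It gives `1 - exp(-1) ≥ 5/8`; the final rate is `5/8 - 1/4 = 3/8`.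
  have he : Real.exp (-1) ≤ 3 / 8 := by
    have := Real.exp_one_gt_d9
    rw [Real.exp_neg, inv_le_comm₀ (Real.exp_pos _) (by norm_num)]
    linarith
  have hmgf : ∀ P : Fin N → α, Real.exp (-((univ.filter fun t => C (P t)).card : ℝ)) =
      ∏ t, Real.exp (-(if C (P t) then 1 else 0)) := by
    intro P
    rw [← Real.exp_sum, sum_neg_distrib, sum_boole]
  calc _ ≤ ∑ P : Fin N → α, (∏ t, w (P t)) *
        (Real.exp (-((univ.filter fun t => C (P t)).card : ℝ)) * Real.exp (N * r / 4)) := by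
        refine sum_le_sum fun P _ => mul_le_mul_of_nonneg_left ?_
          (prod_nonneg fun t _ => hw.1 _)
        split_ifs with h
        · rw [← Real.exp_add]
          exact Real.one_le_exp (by linarith)
        · positivity
    _ = (∑ a, w a * Real.exp (-(if C a then 1 else 0))) ^ N * Real.exp (N * r / 4) := by
        rw [Fintype.sum_pow, sum_mul]
        refine sum_congr rfl fun P _ => ?_
        rw [hmgf, prod_mul_distrib, mul_assoc]
    _ = (1 - r * (1 - Real.exp (-1))) ^ N * Real.exp (N * r / 4) := by
        congr 2
        have h1 : 1 - r * (1 - Real.exp (-1)) = ∑ a, w a -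
            (∑ a, w a * (if C a then 1 else 0)) * (1 - Real.exp (-1)) := by rw [hr, hw.2]
        rw [h1, sum_mul, ← sum_sub_distrib]
        refine sum_congr rfl fun a _ => ?_
        split_ifs
        · ring
        · simp
    _ ≤ Real.exp (-(5 / 8 * r)) ^ N * Real.exp (N * r / 4) := by
        refine mul_le_mul_of_nonneg_right (pow_le_pow_left₀ ?_ ?_ N) (Real.exp_pos _).le
        · have hr1 : r ≤ 1 := by
            rw [← hr]
            refine le_of_le_of_eq ?_ hw.2
            refine sum_le_sum fun a _ => mul_le_of_le_one_right (hw.1 a) ?_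
            split_ifs <;> norm_num
          nlinarith [Real.exp_pos (-1)]
        · have := Real.add_one_le_exp (-(5 / 8 * r))
          nlinarith
    _ = _ := by
        rw [← Real.exp_nat_mul, ← Real.exp_add]
        congr 1
        ring

end FiniteProbability

end PauliTomography

namespace PauliTomography

open Finset Matrix
open scoped ComplexOrder

/-! ### Tensor products and single-qubit Pauli algebra. -/

section Tensor

variable {ι : Type} [Fintype ι]

lemma tensor_mul [DecidableEq ι] (A B : ι → Matrix (Fin 2) (Fin 2) ℂ) :
    tensor A * tensor B = tensor fun i => A i * B i := by
  ext x y
  simp only [tensor, Matrix.mul_apply, Matrix.of_apply]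
  rw [Fintype.prod_sum]
  exact sum_congr rfl fun z _ => prod_mul_distrib.symm

lemma tensor_conjTranspose (A : ι → Matrix (Fin 2) (Fin 2) ℂ) :
    (tensor A)ᴴ = tensor fun i => (A i)ᴴ := by
  ext x y
  simp [tensor]

lemma tensor_one : tensor (fun _ : ι => (1 : Matrix (Fin 2) (Fin 2) ℂ)) = 1 := by
  ext x y
  simp only [tensor, Matrix.of_apply, Matrix.one_apply]
  split_ifs with h
  · simp [h]
  · obtain ⟨i, hi⟩ := Function.ne_iff.1 h
    exact prod_eq_zero (mem_univ i) (by simp [hi])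

lemma trace_tensor [DecidableEq ι] (A : ι → Matrix (Fin 2) (Fin 2) ℂ) :
    (tensor A).trace = ∏ i, (A i).trace := by
  simp only [Matrix.trace, tensor, Matrix.diag, Matrix.of_apply]
  rw [Fintype.prod_sum]

lemma sum_prod_smul_tensor [DecidableEq ι] {β : Type} [Fintype β] (w : ι → β → ℂ)
    (E : ι → β → Matrix (Fin 2) (Fin 2) ℂ) :
    ∑ s : ι → β, (∏ i, w i (s i)) • tensor (fun i => E i (s i)) =
      tensor fun i => ∑ b, w i b • E i b := by
  ext x y
  simp only [tensor, Matrix.sum_apply, Matrix.smul_apply, Matrix.of_apply, smul_eq_mul]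
  rw [Fintype.prod_sum]
  exact sum_congr rfl fun s _ => prod_mul_distrib.symm

end Tensor

lemma sum_axis {M : Type*} [AddCommMonoid M] (f : Axis → M) :
    ∑ a, f a = f .X + f .Y + f .Z := by
  change ∑ a ∈ ({Axis.X, Axis.Y, Axis.Z} : Finset Axis), f a = _
  rw [sum_insert (by decide), sum_insert (by decide), sum_singleton, add_assoc]

lemma pauliI_conjTranspose (o : Option Axis) : (pauliI o)ᴴ = pauliI o := by
  rcases o with _ | _ | _ | _ <;> ext i j <;> fin_cases i <;> fin_cases j <;>
    simp [pauliI, pauli]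

lemma eigenProj_conjTranspose (a : Axis) (b : Fin 2) : (eigenProj a b)ᴴ = eigenProj a b := by
  have h : (pauli a)ᴴ = pauli a := pauliI_conjTranspose (some a)
  simp [eigenProj, conjTranspose_smul, conjTranspose_add, h]

lemma pauli_mul_self (a : Axis) : pauli a * pauli a = 1 := by
  cases a <;> ext i j <;> fin_cases i <;> fin_cases j <;>
    simp [pauli, Matrix.mul_apply]

lemma sgn_mul_self (b : Fin 2) : sgn b * sgn b = 1 := by
  fin_cases b <;> simp [sgn]

lemma eigenProj_mul_self (a : Axis) (b : Fin 2) :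
    eigenProj a b * eigenProj a b = eigenProj a b := by
  have h : ((sgn b : ℝ) : ℂ) * (sgn b : ℝ) = 1 := by exact_mod_cast sgn_mul_self b
  simp only [eigenProj, smul_mul_smul_comm, Matrix.add_mul, Matrix.mul_add, Matrix.one_mul,
    Matrix.mul_one, pauli_mul_self, h]
  ext i j
  simp
  ring

lemma sum_eigenProj (a : Axis) : ∑ b, (1 : ℂ) • eigenProj a b = 1 := by
  ext i j
  simp [Fin.sum_univ_two, eigenProj, sgn]
  ring

lemma sum_sgn_smul_eigenProj (a : Axis) : ∑ b, (sgn b : ℂ) • eigenProj a b = pauli a := by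
  ext i j
  simp [Fin.sum_univ_two, eigenProj, sgn]
  ring

lemma trace_pauliI_mul (o o' : Option Axis) :
    (pauliI o * pauliI o').trace = if o = o' then 2 else 0 := by
  rcases o with _ | _ | _ | _ <;> rcases o' with _ | _ | _ | _ <;>
    simp [pauliI, pauli, Matrix.trace, Fin.sum_univ_two] <;> norm_num

/-- Completeness of the Pauli basis: `∑ σ ⊗ σ` is twice the swap operator. -/
lemma sum_pauliI_mul_pauliI (x y u v : Fin 2) :
    ∑ o, pauliI o x y * pauliI o u v = if x = v ∧ y = u then 2 else 0 := by
  rw [Fintype.sum_option, sum_axis]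
  fin_cases x <;> fin_cases y <;> fin_cases u <;> fin_cases v <;>
    simp [pauliI, pauli] <;> norm_num

/-! ### Pauli expansion and the trace norm. -/

section PauliStrings

variable {ι : Type} [Fintype ι] [DecidableEq ι]

/-- The Pauli string `Q`, as an operator. -/
noncomputable def pauliString (Q : ι → Option Axis) : Op ι := tensor fun i => pauliI (Q i)

omit [DecidableEq ι] in
lemma pauliString_conjTranspose (Q : ι → Option Axis) : (pauliString Q)ᴴ = pauliString Q := by
  simp only [pauliString, tensor_conjTranspose, pauliI_conjTranspose]

lemma trace_pauliString_mul (Q R : ι → Option Axis) :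
    (pauliString Q * pauliString R).trace = if Q = R then 2 ^ Fintype.card ι else 0 := by
  simp only [pauliString, tensor_mul, trace_tensor, trace_pauliI_mul]
  split_ifs with h
  · simp [h]
  · obtain ⟨i, hi⟩ := Function.ne_iff.1 h
    exact prod_eq_zero (mem_univ i) (by simp [hi])

lemma sum_pauliString_mul (x y u v : ι → Fin 2) :
    ∑ Q, pauliString Q x y * pauliString Q u v =
      if x = v ∧ y = u then 2 ^ Fintype.card ι else 0 := by
  simp only [pauliString, tensor, Matrix.of_apply, ← prod_mul_distrib]
  rw [← Fintype.prod_sum fun i o => pauliI o (x i) (y i) * pauliI o (u i) (v i)]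
  simp only [sum_pauliI_mul_pauliI]
  split_ifs with h
  · simp [h]
  · rw [not_and_or] at h
    rcases h with h | h <;> obtain ⟨i, hi⟩ := Function.ne_iff.1 h <;>
      exact prod_eq_zero (mem_univ i) (by simp [hi])

/-- The Pauli expansion of an operator. -/
lemma sum_trace_smul_pauliString (A : Op ι) :
    ∑ Q, ((A * pauliString Q).trace / 2 ^ Fintype.card ι) • pauliString Q = A := by
  ext u v
  simp only [Matrix.sum_apply, Matrix.smul_apply, smul_eq_mul, Matrix.trace, Matrix.diag,
    Matrix.mul_apply, sum_div, sum_mul]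
  rw [sum_comm]
  have h : ∀ x : ι → Fin 2, ∑ Q, ∑ y, A x y * pauliString Q y x / 2 ^ Fintype.card ι *
      pauliString Q u v = if x = u then A x v else 0 := by
    intro x
    rw [sum_comm]
    have h1 : ∀ y, ∑ Q, A x y * pauliString Q y x / 2 ^ Fintype.card ι * pauliString Q u v =
        if y = v then (if x = u then A x v else 0) else 0 := by
      intro y
      have h2 : ∀ Q, A x y * pauliString Q y x / 2 ^ Fintype.card ι * pauliString Q u v =
          A x y / 2 ^ Fintype.card ι * (pauliString Q y x * pauliString Q u v) :=
        fun Q => by ring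
      simp only [h2]
      rw [← mul_sum, sum_pauliString_mul]
      by_cases hy : y = v <;> by_cases hx : x = u <;> simp [hx, hy]
    simp only [h1]
    simp
  simp only [h]
  simp

/-- The trace norm is at most the square root of the dimension times the Frobenius norm. -/
lemma traceNorm_sq_le {m : Type} [Fintype m] [DecidableEq m] (A : Matrix m m ℂ) :
    traceNorm A ^ 2 ≤ Fintype.card m * (Aᴴ * A).trace.re := by
  have hA := isHermitian_conjTranspose_mul_self A
  have h0 : ∀ i, 0 ≤ hA.eigenvalues i := (posSemidef_conjTranspose_mul_self A).eigenvalues_nonneg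
  have h1 : (Aᴴ * A).trace.re = ∑ i, hA.eigenvalues i := by
    rw [hA.trace_eq_sum_eigenvalues]
    simp
  rw [h1, traceNorm]
  refine sq_sum_le_card_mul_sum_sq.trans (le_of_eq ?_)
  rw [card_univ]
  congr 1
  exact sum_congr rfl fun i _ => Real.sq_sqrt (h0 i)

/-- The trace norm of an operator is at most the Euclidean norm of its Pauli coefficients. -/
lemma traceNorm_sum_pauliString_le (c : (ι → Option Axis) → ℝ) :
    traceNorm (∑ Q, ((c Q / 2 ^ Fintype.card ι : ℝ) : ℂ) • pauliString Q) ≤ √(∑ Q, c Q ^ 2) := by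
  refine Real.le_sqrt_of_sq_le ((traceNorm_sq_le _).trans (le_of_eq ?_))
  have h : ((∑ Q, ((c Q / 2 ^ Fintype.card ι : ℝ) : ℂ) • pauliString Q)ᴴ *
      ∑ Q, ((c Q / 2 ^ Fintype.card ι : ℝ) : ℂ) • pauliString Q).trace =
      ((∑ Q, c Q ^ 2) / 2 ^ Fintype.card ι : ℝ) := by
    rw [conjTranspose_sum, sum_mul, trace_sum]
    simp only [mul_sum, trace_sum, conjTranspose_smul, pauliString_conjTranspose,
      smul_mul_smul_comm, trace_smul, trace_pauliString_mul, smul_eq_mul, mul_ite, mul_zero]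
    simp only [sum_ite_eq, mem_univ, if_true]
    push_cast
    rw [sum_div]
    refine sum_congr rfl fun Q _ => ?_
    simp only [RCLike.star_def, map_div₀, map_pow, Complex.conj_ofReal, map_ofNat]
    field_simp
  rw [h, Complex.ofReal_re]
  simp only [Fintype.card_fun, Fintype.card_fin]
  push_cast
  field_simp

end PauliStrings

/-! ### Reduced states and Born probabilities. -/

section Marginal

variable {n : ℕ}

/-- The operator on the whole register that is `A i` on the qubits of `S` and the identity on
the other qubits. -/
noncomputable def padded (S : Finset (Fin n)) (A : S → Matrix (Fin 2) (Fin 2) ℂ) : Op (Fin n) :=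
  tensor fun i => if h : i ∈ S then A ⟨i, h⟩ else 1

lemma sum_glue {M : Type*} [AddCommMonoid M] (S : Finset (Fin n)) (F : (Fin n → Fin 2) → M) :
    ∑ x, F x = ∑ a : S → Fin 2, ∑ c : {i // i ∉ S} → Fin 2, F (glue S a c) := by
  rw [← (Equiv.piEquivPiSubtypeProd (fun i => i ∈ S) fun _ => Fin 2).symm.sum_comp,
    Fintype.sum_prod_type]
  rfl

lemma padded_glue (S : Finset (Fin n)) (A : S → Matrix (Fin 2) (Fin 2) ℂ)
    (a b : S → Fin 2) (c d : {i // i ∉ S} → Fin 2) :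
    padded S A (glue S a c) (glue S b d) = if c = d then tensor A a b else 0 := by
  have h1 : padded S A (glue S a c) (glue S b d) =
      tensor A a b * tensor (fun _ : {i // i ∉ S} => (1 : Matrix (Fin 2) (Fin 2) ℂ)) c d := by
    simp only [padded, tensor, Matrix.of_apply]
    rw [← Fintype.prod_subtype_mul_prod_subtype (fun i => i ∈ S)]
    congr 1
    · refine prod_congr (by ext; simp) fun i _ => ?_
      have hi : i.1 ∈ S := i.2
      simp [glue, hi]
    · refine prod_congr rfl fun i _ => ?_
      have hi : i.1 ∉ S := i.2
      simp only [glue, hi, dif_neg, not_false_eq_true]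
  rw [h1, tensor_one, Matrix.one_apply]
  split_ifs <;> simp

/-- Partial trace is adjoint to padding with identities: a padded operator is diagonal in the labels
off `S`. -/
lemma trace_marginal_mul_tensor (S : Finset (Fin n)) (ρ : Op (Fin n))
    (A : S → Matrix (Fin 2) (Fin 2) ℂ) :
    (marginal S ρ * tensor A).trace = (ρ * padded S A).trace := by
  simp only [Matrix.trace, Matrix.diag, Matrix.mul_apply]
  rw [sum_glue S]
  refine sum_congr rfl fun a _ => ?_
  have h : ∀ c : {i // i ∉ S} → Fin 2, ∑ y, ρ (glue S a c) y * padded S A y (glue S a c) =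
      ∑ b, ρ (glue S a c) (glue S b c) * tensor A b a := by
    intro c
    rw [sum_glue S]
    refine sum_congr rfl fun b _ => ?_
    simp [padded_glue]
  simp only [h]
  rw [sum_comm]
  refine sum_congr rfl fun b _ => ?_
  simp [marginal, sum_mul]

/-- The Born probability of the outcome bits `s` when qubit `i` is measured in basis `P i`. -/
noncomputable def bornProb (ρ : Op (Fin n)) (P : Fin n → Axis) (s : Fin n → Fin 2) : ℝ :=
  (ρ * tensor fun i => eigenProj (P i) (s i)).trace.re

lemma sum_prod_mul_bornProb (ρ : Op (Fin n)) (P : Fin n → Axis) (w : Fin n → Fin 2 → ℝ) :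
    ∑ s, bornProb ρ P s * ∏ i, w i (s i) =
      (ρ * tensor fun i => ∑ b, (w i b : ℂ) • eigenProj (P i) b).trace.re := by
  rw [← sum_prod_smul_tensor (fun i b => (w i b : ℂ)) fun i b => eigenProj (P i) b, mul_sum,
    trace_sum, Complex.re_sum]
  refine sum_congr rfl fun s _ => ?_
  rw [Matrix.mul_smul, trace_smul, smul_eq_mul, ← Complex.ofReal_prod, Complex.re_ofReal_mul,
    bornProb, mul_comm]

lemma bornProb_mem_stdSimplex {ρ : Op (Fin n)} (hρ : IsDensity ρ) (P : Fin n → Axis) :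
    bornProb ρ P ∈ stdSimplex ℝ (Fin n → Fin 2) := by
  constructor
  · intro s
    set T : Op (Fin n) := tensor fun i => eigenProj (P i) (s i) with hT
    have h1 : Tᴴ = T := by
      rw [hT, tensor_conjTranspose]
      simp only [eigenProj_conjTranspose]
    have h2 : T * T = T := by
      rw [hT, tensor_mul]
      simp only [eigenProj_mul_self]
    have h3 : (ρ * T).trace = (T * ρ * Tᴴ).trace := by
      rw [h1, Matrix.mul_assoc, trace_mul_comm T, Matrix.mul_assoc, h2]
    have h4 := (hρ.1.mul_mul_conjTranspose_same T).trace_nonneg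
    rw [← h3] at h4
    exact (Complex.le_def.1 h4).1
  · have h := sum_prod_mul_bornProb ρ P fun _ _ => 1
    simp only [prod_const_one, mul_one, Complex.ofReal_one, sum_eigenProj, tensor_one] at h
    rw [h, hρ.2, Complex.one_re]

/-- The expectation value of the Pauli string `Q` on the qubits of `S` in the state `ρ`. -/
noncomputable def pauliMean (S : Finset (Fin n)) (ρ : Op (Fin n)) (Q : S → Option Axis) : ℝ :=
  (ρ * padded S fun i => pauliI (Q i)).trace.re

/-- A product of two Hermitian operators has real trace, so the real part in `pauliMean` loses
nothing. -/
lemma trace_marginal_mul_pauliString (S : Finset (Fin n)) {ρ : Op (Fin n)} (hρ : ρ.IsHermitian)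
    (Q : S → Option Axis) :
    (marginal S ρ * pauliString Q).trace = pauliMean S ρ Q := by
  rw [pauliString, trace_marginal_mul_tensor, pauliMean]
  refine (Complex.conj_eq_iff_re.1 ?_).symm
  have h : (padded S fun i => pauliI (Q i))ᴴ = padded S fun i => pauliI (Q i) := by
    rw [padded, tensor_conjTranspose]
    congr 1
    funext i
    split_ifs <;> simp [pauliI_conjTranspose]
  rw [starRingEnd_apply, ← trace_conjTranspose, conjTranspose_mul, h, hρ.eq, trace_mul_comm]

lemma outcomeValue_eq_prod {S : Finset (Fin n)} (Q : S → Option Axis) (s : Fin n → Fin 2) :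
    outcomeValue Q s =
      ∏ i, if h : i ∈ S then (if Q ⟨i, h⟩ = none then 1 else sgn (s i)) else 1 := by
  rw [← Fintype.prod_subtype_mul_prod_subtype (fun i => i ∈ S)]
  have h2 : (∏ i : {i // i ∉ S}, if h : i.1 ∈ S then
      (if Q ⟨i, h⟩ = none then 1 else sgn (s i)) else (1 : ℝ)) = 1 :=
    prod_eq_one fun i _ => by simp [i.2]
  rw [h2, mul_one, outcomeValue]
  exact prod_congr (by ext; simp) fun i _ => by simp

/-- Useful rounds are unbiased whatever the bases elsewhere: summing eigenprojectors with signs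
gives the Pauli operator, without signs the identity. -/
lemma sum_bornProb_mul_outcomeValue {S : Finset (Fin n)} {Q : S → Option Axis}
    {P : Fin n → Axis} (h : Corresponds Q P) (ρ : Op (Fin n)) :
    ∑ s, bornProb ρ P s * outcomeValue Q s = pauliMean S ρ Q := by
  simp only [outcomeValue_eq_prod]
  rw [sum_prod_mul_bornProb ρ P fun i b =>
    if h : i ∈ S then (if Q ⟨i, h⟩ = none then 1 else sgn b) else 1, pauliMean, padded]
  congr 4
  funext i
  split_ifs with hi h'
  · simpa [h', pauliI] using sum_eigenProj (P i)
  · rw [(h ⟨i, hi⟩).resolve_left h']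
    exact sum_sgn_smul_eigenProj (P i)
  · simpa using sum_eigenProj (P i)

lemma abs_outcomeValue_le {S : Finset (Fin n)} (Q : S → Option Axis) (s : Fin n → Fin 2) :
    |outcomeValue Q s| ≤ 1 := by
  rw [outcomeValue, abs_prod]
  refine prod_le_one (fun i _ => abs_nonneg _) fun i _ => ?_
  split_ifs
  · simp
  · rw [sgn]; split_ifs <;> simp

lemma traceNorm_estimate_sub_marginal_le {N : ℕ} (S : Finset (Fin n)) {ρ : Op (Fin n)}
    (hρ : ρ.IsHermitian) (ω : Fin N → Round n) :
    traceNorm (estimate S ω - marginal S ρ) ≤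
      √(∑ Q : S → Option Axis, (empiricalMean ω Q - pauliMean S ρ Q) ^ 2) := by
  have h : estimate S ω - marginal S ρ = ∑ Q : S → Option Axis,
      (((empiricalMean ω Q - pauliMean S ρ Q) / 2 ^ Fintype.card S : ℝ) : ℂ) •
        pauliString Q := by
    conv_lhs => rw [← sum_trace_smul_pauliString (marginal S ρ)]
    rw [estimate, ← sum_sub_distrib]
    refine sum_congr rfl fun Q _ => ?_
    rw [trace_marginal_mul_pauliString S hρ, Fintype.card_coe]
    change _ • pauliString Q - _ = _
    rw [← sub_smul]
    congr 1
    push_cast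
    ring
  rw [h]
  exact traceNorm_sum_pauliString_le _

end Marginal

end PauliTomography

namespace PauliTomography

open Finset
open scoped ComplexOrder

/-! ### Random bases, one marginal, and the union bound. -/

section Assembly

variable {n : ℕ}

/-- The probability that a round of random Pauli measurements is useful for `Q`. -/
noncomputable def usefulProb {S : Finset (Fin n)} (Q : S → Option Axis) : ℝ :=
  ∏ i, if Q i = none then 1 else 1 / 3

lemma usefulProb_pos {S : Finset (Fin n)} (Q : S → Option Axis) : 0 < usefulProb Q :=
  prod_pos fun i _ => by split_ifs <;> norm_num

lemma pow_card_le_usefulProb {S : Finset (Fin n)} (Q : S → Option Axis) :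
    (1 / 3 : ℝ) ^ S.card ≤ usefulProb Q := by
  have h : (1 / 3 : ℝ) ^ S.card = ∏ _i : S, (1 / 3 : ℝ) := by simp
  rw [h]
  exact prod_le_prod (fun _ _ => by norm_num) fun i _ => by split_ifs <;> norm_num

lemma card_axis : Fintype.card Axis = 3 := rfl

/-- The sum factors over qubits; each contributes `1` for the identity and `3` for each of three
axes. -/
lemma sum_inv_usefulProb (S : Finset (Fin n)) :
    ∑ Q : S → Option Axis, (usefulProb Q)⁻¹ = 10 ^ S.card := by
  simp only [usefulProb, ← prod_inv_distrib]
  rw [← Fintype.prod_sum fun (_ : S) (o : Option Axis) =>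
    (if o = none then (1 : ℝ) else 1 / 3)⁻¹]
  simp [card_axis]
  norm_num

lemma uniform_mem_stdSimplex :
    (fun _ => (1 / 3) ^ n : (Fin n → Axis) → ℝ) ∈ stdSimplex ℝ (Fin n → Axis) := by
  refine ⟨fun _ => by positivity, ?_⟩
  simp [card_axis]

open Classical in
lemma sum_uniform_corresponds {S : Finset (Fin n)} (Q : S → Option Axis) :
    ∑ P : Fin n → Axis, (1 / 3 : ℝ) ^ n * (if Corresponds Q P then 1 else 0) =
      usefulProb Q := by
  have h1 : ∀ P : Fin n → Axis, (1 / 3 : ℝ) ^ n * (if Corresponds Q P then 1 else 0) =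
      ∏ i, 1 / 3 * (if h : i ∈ S then
        (if Q ⟨i, h⟩ = none ∨ Q ⟨i, h⟩ = some (P i) then 1 else 0) else 1) := by
    intro P
    rw [prod_mul_distrib, prod_const, card_univ, Fintype.card_fin]
    congr 1
    split_ifs with h
    · refine (prod_eq_one fun i _ => ?_).symm
      split_ifs with hi h'
      · rfl
      · exact absurd (h ⟨i, hi⟩) h'
      · rfl
    · simp only [Corresponds, not_forall] at h
      obtain ⟨i, hi⟩ := h
      exact (prod_eq_zero (mem_univ i.1) (by simp only [i.2, dif_pos]; rw [if_neg hi])).symm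
  simp only [h1]
  rw [← Fintype.prod_sum fun (i : Fin n) (a : Axis) => (1 / 3 : ℝ) * (if h : i ∈ S then
    (if Q ⟨i, h⟩ = none ∨ Q ⟨i, h⟩ = some a then 1 else 0) else 1),
    ← Fintype.prod_subtype_mul_prod_subtype (fun i => i ∈ S)]
  have h2 : (∏ i : {i // i ∉ S}, ∑ a : Axis, (1 / 3 : ℝ) * (if h : i.1 ∈ S then
      (if Q ⟨i, h⟩ = none ∨ Q ⟨i, h⟩ = some a then 1 else 0) else 1)) = 1 :=
    prod_eq_one fun i _ => by simp [i.2, card_axis]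
  rw [h2, mul_one, usefulProb]
  refine prod_congr (by ext; simp) fun i _ => ?_
  have hi : i.1 ∈ S := i.2
  simp only [hi, dif_pos, Subtype.coe_eta]
  rcases Q i with _ | b
  · simp [card_axis]
  · cases b <;> simp

lemma sum_rounds {M : Type*} [AddCommMonoid M] {N : ℕ} (F : (Fin N → Round n) → M) :
    ∑ ω, F ω = ∑ P : Fin N → Fin n → Axis, ∑ s : Fin N → Fin n → Fin 2,
      F fun t => (P t, s t) := by
  rw [← (Equiv.arrowProdEquivProdArrow (Fin N) (fun _ => Fin n → Axis)
    fun _ => Fin n → Fin 2).symm.sum_comp, Fintype.sum_prod_type]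
  rfl

lemma dataProb_eq {N : ℕ} (ρ : Op (Fin n)) (P : Fin N → Fin n → Axis)
    (s : Fin N → Fin n → Fin 2) :
    dataProb ρ (fun t => (P t, s t)) =
      (∏ _t : Fin N, (1 / 3 : ℝ) ^ n) * ∏ t, bornProb ρ (P t) (s t) := by
  rw [← prod_mul_distrib]
  rfl

lemma dataProb_nonneg {N : ℕ} {ρ : Op (Fin n)} (hρ : IsDensity ρ) (ω : Fin N → Round n) :
    0 ≤ dataProb ρ ω :=
  prod_nonneg fun t _ =>
    mul_nonneg (by positivity) ((bornProb_mem_stdSimplex hρ (ω t).1).1 (ω t).2)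

lemma sum_dataProb {N : ℕ} {ρ : Op (Fin n)} (hρ : IsDensity ρ) :
    ∑ ω : Fin N → Round n, dataProb ρ ω = 1 := by
  simp only [sum_rounds, dataProb_eq, ← mul_sum,
    sum_prod_eq_one fun t => bornProb_mem_stdSimplex hρ _, mul_one]
  exact sum_prod_eq_one fun _ => uniform_mem_stdSimplex

/-- The exponent is at least `3x (10/3)^k ≥ 3x + 7kx` by Bernoulli's inequality. As `x ≥ log 2`,
this beats `x + k log 4`. -/
lemma four_pow_mul_exp_le {k N : ℕ} {x : ℝ} (hx : Real.log 2 ≤ x)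
    (hxN : 8 * 10 ^ k * x ≤ N) :
    (4 : ℝ) ^ k * Real.exp (-(3 / 8 * (N * (1 / 3) ^ k))) ≤ Real.exp (-x) := by
  have hl := Real.log_two_gt_d9
  have h4 : (4 : ℝ) ^ k ≤ Real.exp (1.4 * k) := by
    have : (4 : ℝ) ≤ Real.exp 1.4 := by
      have h2 : Real.log 4 = 2 * Real.log 2 := by
        rw [show (4 : ℝ) = 2 ^ 2 by norm_num, Real.log_pow]; norm_num
      rw [← Real.log_le_iff_le_exp (by norm_num), h2]
      linarith [Real.log_two_lt_d9]
    calc (4 : ℝ) ^ k ≤ Real.exp 1.4 ^ k := pow_le_pow_left₀ (by norm_num) this k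
      _ = Real.exp (1.4 * k) := by rw [← Real.exp_nat_mul, mul_comm]
  refine (mul_le_mul_of_nonneg_right h4 (Real.exp_pos _).le).trans ?_
  rw [← Real.exp_add, Real.exp_le_exp]
  have hb : 1 + (k : ℝ) * (7 / 3) ≤ (10 / 3 : ℝ) ^ k := by
    have := one_add_mul_le_pow (a := (7 / 3 : ℝ)) (by norm_num) k
    norm_num at this
    linarith
  have h1 : 8 * x * (10 / 3 : ℝ) ^ k ≤ N * (1 / 3) ^ k := by
    have := mul_le_mul_of_nonneg_right hxN (by positivity : (0 : ℝ) ≤ (1 / 3) ^ k)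
    have h2 : (10 : ℝ) ^ k * (1 / 3) ^ k = (10 / 3) ^ k := by rw [← mul_pow]; norm_num
    nlinarith
  have h3 : 8 * x * (1 + (k : ℝ) * (7 / 3)) ≤ 8 * x * (10 / 3 : ℝ) ^ k :=
    mul_le_mul_of_nonneg_left hb (by linarith)
  have hk : (0 : ℝ) ≤ k := k.cast_nonneg
  nlinarith

open Classical in
/-- The probability that the estimate of a single marginal fails. -/
lemma sum_dataProb_failure_le {N : ℕ} {ρ : Op (Fin n)} (hρ : IsDensity ρ) (S : Finset (Fin n))
    {ε x : ℝ} (hε : 0 < ε) (hε2 : ε ≤ 2) (hx : Real.log 2 ≤ x)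
    (hN : (N : ℝ) * ε ^ 2 = 32 * 10 ^ S.card * x) :
    (∑ ω : Fin N → Round n,
      if traceNorm (estimate S ω - marginal S ρ) ≤ ε then 0 else dataProb ρ ω) ≤
      2 * Real.exp (-x) := by
  have hl := Real.log_two_gt_d9
  have hx0 : 0 < x := by linarith
  have h10 : (0 : ℝ) < 10 ^ S.card := by positivity
  have hN0 : (0 : ℝ) < N := by
    have h : 0 < (N : ℝ) * ε ^ 2 := hN ▸ by positivity
    exact pos_of_mul_pos_left h (by positivity)
  have hxN : 8 * 10 ^ S.card * x ≤ N := by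
    have h : ε ^ 2 ≤ 4 := by nlinarith
    have := mul_le_mul_of_nonneg_left h hN0.le
    linarith
  let w : (Fin n → Axis) → ℝ := fun _ => (1 / 3) ^ n
  let m : (Fin N → Fin n → Axis) → (S → Option Axis) → ℝ := fun P Q =>
    ((univ.filter fun t => Corresponds Q (P t)).card : ℝ)
  have hinner : ∀ P : Fin N → Fin n → Axis,
      (∑ s : Fin N → Fin n → Fin 2, (∏ t, bornProb ρ (P t) (s t)) *
        if traceNorm (estimate S (fun t => (P t, s t)) - marginal S ρ) ≤ ε then 0 else 1) ≤
      Real.exp (-x) + ∑ Q : S → Option Axis,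
        if m P Q < N * usefulProb Q / 4 then 1 else 0 := by
    intro P
    have hq : ∀ t, bornProb ρ (P t) ∈ stdSimplex ℝ _ := fun t => bornProb_mem_stdSimplex hρ _
    have hq0 : ∀ s : Fin N → Fin n → Fin 2, 0 ≤ ∏ t, bornProb ρ (P t) (s t) := fun s =>
      prod_nonneg fun t _ => (hq t).1 _
    -- If some string has too few samples, the indicator sum alone is at least `1`. Otherwise every
    -- count is positive and the default value `0` of an empty mean never arises.
    by_cases hbad : ∃ Q : S → Option Axis, m P Q < N * usefulProb Q / 4
    · obtain ⟨Q, hQ⟩ := hbad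
      have h1 : (1 : ℝ) ≤ ∑ Q : S → Option Axis,
          if m P Q < N * usefulProb Q / 4 then 1 else 0 := by
        refine le_trans (by rw [if_pos hQ]) (single_le_sum
          (f := fun Q => if m P Q < N * usefulProb Q / 4 then (1 : ℝ) else 0)
          (fun Q _ => ?_) (mem_univ Q))
        split_ifs <;> norm_num
      have h2 : (∑ s : Fin N → Fin n → Fin 2, (∏ t, bornProb ρ (P t) (s t)) *
          if traceNorm (estimate S (fun t => (P t, s t)) - marginal S ρ) ≤ ε then 0 else 1) ≤
          1 := by
        refine le_of_le_of_eq ?_ (sum_prod_eq_one hq)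
        refine sum_le_sum fun s _ => mul_le_of_le_one_right (hq0 s) ?_
        split_ifs <;> norm_num
      linarith [Real.exp_pos (-x)]
    · simp only [not_exists, not_lt] at hbad
      have hpos : ∀ Q : S → Option Axis, 0 < N * usefulProb Q / 4 := fun Q => by
        have := usefulProb_pos Q
        positivity
      have htail := sum_prod_empirical_tail hq
        (fun Q : S → Option Axis => univ.filter fun t => Corresponds Q (P t))
        (fun Q => card_pos.1 (Nat.cast_pos.1 ((hpos Q).trans_le (hbad Q))))
        (v := fun Q s => outcomeValue Q s) (fun Q s => abs_outcomeValue_le Q s)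
        (μ := fun Q => pauliMean S ρ Q)
        (fun Q t ht => sum_bornProb_mul_outcomeValue (mem_filter.1 ht).2 ρ)
        (V := 4 * 10 ^ S.card / N) (ε := ε) (by positivity) hε
        (by
          rw [← sum_inv_usefulProb, mul_sum, sum_div]
          refine sum_le_sum fun Q _ => ?_
          refine (one_div_le_one_div_of_le (hpos Q) (hbad Q)).trans (le_of_eq ?_)
          have := (usefulProb_pos Q).ne'
          field_simp)
        -- `4V ≤ ε²` amounts to `16·10^k ≤ N ε² = 32·10^k x`, true because `x ≥ log 2 > 1/2`.
        (by
          rw [mul_div_assoc', div_le_iff₀ hN0]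
          nlinarith)
      have hexp : ε ^ 2 / (8 * (4 * 10 ^ S.card / N)) = x := by
        field_simp
        linarith
      rw [hexp] at htail
      have h1 : (0 : ℝ) ≤ ∑ Q : S → Option Axis,
          if m P Q < N * usefulProb Q / 4 then 1 else 0 :=
        sum_nonneg fun Q _ => by split_ifs <;> norm_num
      refine le_trans (sum_le_sum fun s _ => mul_le_mul_of_nonneg_left ?_ (hq0 s))
        (htail.trans (le_add_of_nonneg_right h1))
      have h2 := traceNorm_estimate_sub_marginal_le S hρ.1.isHermitian fun t => (P t, s t)
      split_ifs with h3 h4 h4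
      · exact le_rfl
      · norm_num
      · exact absurd (h2.trans h4) h3
      · exact le_rfl
  calc _ = ∑ P : Fin N → Fin n → Axis, (∏ t, w (P t)) *
        ∑ s : Fin N → Fin n → Fin 2, (∏ t, bornProb ρ (P t) (s t)) *
          if traceNorm (estimate S (fun t => (P t, s t)) - marginal S ρ) ≤ ε then 0 else 1 := by
        rw [sum_rounds]
        refine sum_congr rfl fun P _ => ?_
        rw [mul_sum]
        refine sum_congr rfl fun s _ => ?_
        rw [dataProb_eq]
        split_ifs
        · simp
        · rw [mul_one]
    _ ≤ ∑ P : Fin N → Fin n → Axis, (∏ t, w (P t)) *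
        (Real.exp (-x) + ∑ Q : S → Option Axis,
          if m P Q < N * usefulProb Q / 4 then 1 else 0) :=
        sum_le_sum fun P _ => mul_le_mul_of_nonneg_left (hinner P)
          (prod_nonneg fun t _ => uniform_mem_stdSimplex.1 (P t))
    _ = Real.exp (-x) + ∑ Q : S → Option Axis, ∑ P : Fin N → Fin n → Axis, (∏ t, w (P t)) *
          if m P Q < N * usefulProb Q / 4 then 1 else 0 := by
        simp only [mul_add, sum_add_distrib, mul_sum]
        rw [← sum_mul, sum_prod_eq_one fun _ => uniform_mem_stdSimplex, one_mul, sum_comm]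
    _ ≤ Real.exp (-x) + ∑ Q : S → Option Axis,
          Real.exp (-(3 / 8 * (N * (1 / 3) ^ S.card))) := by
        refine add_le_add le_rfl (sum_le_sum fun Q _ => ?_)
        refine (sum_prod_card_lt_le uniform_mem_stdSimplex (Corresponds Q)
          (sum_uniform_corresponds Q) N).trans (Real.exp_le_exp.2 ?_)
        have := mul_le_mul_of_nonneg_left (pow_card_le_usefulProb Q) hN0.le
        linarith
    _ ≤ _ := by
        have h := four_pow_mul_exp_le hx hxN
        rw [sum_const, card_univ, Fintype.card_fun, Fintype.card_option, card_axis,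
          Fintype.card_coe, nsmul_eq_mul]
        push_cast
        norm_num at h ⊢
        linarith

lemma one_sub_le_successProb {N k : ℕ} {ρ : Op (Fin n)} (hρ : IsDensity ρ)
    {F : Finset (Finset (Fin n))} (hF : ∀ S ∈ F, S.card = k) (hF1 : 1 ≤ F.card)
    {ε δ : ℝ} (hε : 0 < ε) (hε2 : ε ≤ 2) (hδ : 0 < δ) (hδ1 : δ < 1)
    (hN : 32 * 10 ^ k / ε ^ 2 * Real.log (2 * F.card / δ) ≤ N) :
    1 - δ ≤ successProb ρ N F ε := by
  classical
  have hF1' : (1 : ℝ) ≤ F.card := by exact_mod_cast hF1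
  -- Choosing `x` from `N`, not from `δ`, makes the relation required of `N` an equality.
  set x : ℝ := N * ε ^ 2 / (32 * 10 ^ k) with hx
  have hxl : Real.log (2 * F.card / δ) ≤ x := by
    rw [hx, le_div_iff₀ (by positivity)]
    rw [div_mul_eq_mul_div, div_le_iff₀ (by positivity)] at hN
    linarith
  have hx2 : Real.log 2 ≤ x := by
    refine le_trans (Real.log_le_log (by norm_num) ?_) hxl
    rw [le_div_iff₀ hδ]
    nlinarith
  have hfail : 1 - successProb ρ N F ε ≤ ∑ S ∈ F, ∑ ω : Fin N → Round n,
      if traceNorm (estimate S ω - marginal S ρ) ≤ ε then 0 else dataProb ρ ω := by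
    rw [← sum_dataProb (N := N) hρ, successProb, ← sum_sub_distrib, sum_comm]
    refine sum_le_sum fun ω _ => ?_
    have h0 : ∀ S ∈ F, 0 ≤ if traceNorm (estimate S ω - marginal S ρ) ≤ ε then 0
        else dataProb ρ ω := fun S _ => by
      split_ifs
      · exact le_rfl
      · exact dataProb_nonneg hρ ω
    by_cases h : ∀ S ∈ F, traceNorm (estimate S ω - marginal S ρ) ≤ ε
    · rw [if_pos h, sub_self]
      exact sum_nonneg h0
    · rw [if_neg h, sub_zero]
      push Not at h
      obtain ⟨S, hS, hSε⟩ := h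
      refine le_trans ?_ (single_le_sum h0 hS)
      rw [if_neg hSε.not_ge]
  have hsum : (∑ S ∈ F, ∑ ω : Fin N → Round n,
      if traceNorm (estimate S ω - marginal S ρ) ≤ ε then 0 else dataProb ρ ω) ≤
      F.card * (2 * Real.exp (-x)) := by
    rw [← nsmul_eq_mul]
    refine sum_le_card_nsmul _ _ _ fun S hS => ?_
    refine sum_dataProb_failure_le hρ S hε hε2 hx2 ?_
    rw [hF S hS, hx]
    field_simp
  have hδx : F.card * (2 * Real.exp (-x)) ≤ δ := by
    rw [Real.log_le_iff_le_exp (by positivity), div_le_iff₀ hδ] at hxl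
    rw [Real.exp_neg, ← mul_assoc, ← div_eq_mul_inv, div_le_iff₀ (Real.exp_pos _)]
    linarith
  linarith

end Assembly

end PauliTomography

theorem mainTheorem9 :
    (∀ (n k N : ℕ) (ε δ : ℝ), k ≤ n → 0 < ε → ε ≤ 2 → 0 < δ → δ < 1 →
      32 * 10 ^ k / ε ^ 2 * Real.log (2 * (n.choose k : ℝ) / δ) ≤ (N : ℝ) →
      ∀ ρ : PauliTomography.Op (Fin n), PauliTomography.IsDensity ρ →
        1 - δ ≤ PauliTomography.successProb ρ N
          (Finset.powersetCard k (Finset.univ : Finset (Fin n))) ε) ∧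
    (∀ δ : ℝ, 0 < δ → δ < 1 → ∃ C : ℝ, 0 < C ∧
      ∀ (n k N : ℕ) (F : Finset (Finset (Fin n))) (ε : ℝ),
        (∀ S ∈ F, S.card = k) → 2 ≤ F.card → 0 < ε → ε ≤ 2 →
        C * (10 ^ k * Real.log (F.card : ℝ) / ε ^ 2) ≤ (N : ℝ) →
        ∀ ρ : PauliTomography.Op (Fin n), PauliTomography.IsDensity ρ →
          1 - δ ≤ PauliTomography.successProb ρ N F ε) := by
  constructor
  · intro n k N ε δ hk hε hε2 hδ hδ1 hN ρ hρ
    have hcard : (Finset.powersetCard k (Finset.univ : Finset (Fin n))).card = n.choose k := by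
      simp
    refine PauliTomography.one_sub_le_successProb (k := k) hρ
      (fun S hS => (Finset.mem_powersetCard.1 hS).2) ?_ hε hε2 hδ hδ1 ?_
    · rw [hcard]
      exact Nat.choose_pos hk
    · rwa [hcard]
  · intro δ hδ hδ1
    have hl2 : 0 < Real.log 2 := Real.log_pos (by norm_num)
    have hlδ : 0 < Real.log (2 / δ) := Real.log_pos (by rw [lt_div_iff₀ hδ]; linarith)
    -- Since `m ≥ 2`, the term `log (2/δ)` is at most `log (2/δ) / log 2` times `log m`.
    refine ⟨32 * (1 + Real.log (2 / δ) / Real.log 2), by positivity, ?_⟩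
    intro n k N F ε hF hF2 hε hε2 hN ρ hρ
    refine PauliTomography.one_sub_le_successProb hρ hF (by omega) hε hε2 hδ hδ1
      (le_trans ?_ hN)
    have hm : (2 : ℝ) ≤ F.card := by exact_mod_cast hF2
    have hlm : Real.log 2 ≤ Real.log F.card := Real.log_le_log (by norm_num) hm
    have h1 : Real.log (2 * F.card / δ) = Real.log F.card + Real.log (2 / δ) := by
      rw [← Real.log_mul (by positivity) (by positivity)]
      congr 1
      ring
    have h2 : Real.log (2 / δ) ≤ Real.log (2 / δ) / Real.log 2 * Real.log F.card := by
      rw [div_mul_eq_mul_div, le_div_iff₀ hl2]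
      exact mul_le_mul_of_nonneg_left hlm hlδ.le
    have h3 : Real.log (2 * F.card / δ) ≤
        (1 + Real.log (2 / δ) / Real.log 2) * Real.log F.card := by
      rw [h1]; linarith
    calc _ ≤ 32 * 10 ^ k / ε ^ 2 *
          ((1 + Real.log (2 / δ) / Real.log 2) * Real.log F.card) :=
          mul_le_mul_of_nonneg_left h3 (by positivity)
      _ = _ := by ring
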